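/- Let $\mathfrak g$ be a finite-dimensional complex Lie algebra and $\rho:\mathfrak g\to\mathrm{gl}(V)$ a representation on a finite-dimensional complex vector space $V$. For $x\in V$ let $R_x:\mathfrak g\to V$, $R_x(\xi)=\rho(\xi)x$, and let $r=\max_{x\in V}\mathrm{rk}\,R_x$. A point $a\in V$ is regular if $\dim\mathrm{Ker}\,R_a\le\dim\mathrm{Ker}\,R_x$ for all $x\in V$; $\mathsf{Sing}\subset V$ is the set of non-regular points. By the Kronecker canonical form of a pencil $A+\lambda B$ of linear maps $A,B:U\to W$ we mean a simultaneous block-diagonal form of $(A,B)$, in suitable bases of $U$ and $W$, whose blocks $(A_i,B_i)$ are: Jordan blocks of size $n\times n$, $n\ge1$, with eigenvalue $c\in\mathbb C$ ($A_i=cI+N$, $B_i=I$) or with eigenvalue $\infty$ ($A_i=I$, $B_i=N$), where $N$ is the nilpotent matrix with ones on the superdiagonal; horizontal Kronecker blocks of size $\varepsilon\times(\varepsilon+1)$, $\varepsilon\ge0$ ($A_i=(I\;0)$, $B_i=(0\;I)$); and vertical Kronecker blocks of size $(\eta+1)\times\eta$, $\eta\ge0$ (the transposes of horizontal ones). The algebraic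 type of the pencil consists of the sizes of the Jordan blocks grouped by eigenvalue (forgetting the values of the eigenvalues), the numbers $\varepsilon$ of its horizontal blocks and the numbers $\eta$ of its vertical blocks. A pair $(x,a)\in V\times V$ is generic if the pencil $R_x+\lambda R_a$ has the algebraic type shared by all the pencils $R_y+\lambda R_b$ with $(y,b)$ in some nonempty Zariski open subset of $V\times V$. Let the fundamental semi-invariant $\mathsf p_\rho$ (defined up to a nonzero constant) be the greatest common divisor of all $r\times r$ minors of the matrix of $R_x$ in bases of $\mathfrak g$ and $V$, viewed as polynomials in the coordinates of $x$. Then: 1. If $a\in V$ is regular and $x\in V$ is arbitrary, then in any Kronecker canonical form of the pencil $R_x+\lambda R_a=R_{x+\lambda a}$ the set of eigenvalues of the Jordan blocks is $\{\lambda\in\mathbb C : x-\lambda a\in\mathsf{Sing}\}$; in particular $\infty$ is not an eigenvalue. 2. For a generic pencil $R_{x+\lambda a}$, $\deg\mathsf p_\rho$ equals the sum of the sizes of all Jordan blocks. That is, this equality holds, for any Kronecker canonical form of $R_{x+\lambda a}$, for every generic pair $(x,a)$; and it holds for all pairs $(x,a)$ in some nonempty Zariski open subset of $V\times V$. -/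

import Mathlib

noncomputable section

namespace JordanKronecker

/-! ### Kronecker canonical form of a pencil `A + lambda B` -/

/-- The indecomposable blocks of the canonical form of a pair of linear maps.
The sizes (rows times columns) are `n × n` with `n ≥ 1` for the two kinds of Jordan blocks,
`e × (e + 1)` for a horizontal and `(e + 1) × e` for a vertical Kronecker block, `e ≥ 0`.
A zero matrix with `g` rows and `h` columns is the sum of `g` vertical blocks of size `1 × 0`
and `h` horizontal blocks of size `0 × 1`. -/
inductive Block : Type
  /-- Jordan block with a finite eigenvalue -/
  | jordan (c : ℂ) (n : ℕ+) : Block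
  /-- Jordan block with eigenvalue `∞` -/
  | jordanInfty (n : ℕ+) : Block
  /-- horizontal Kronecker block -/
  | hor (e : ℕ) : Block
  /-- vertical Kronecker block -/
  | vert (e : ℕ) : Block

namespace Block

/-- Number of rows. -/
def rows : Block → ℕ
  | jordan _ n => n
  | jordanInfty n => n
  | hor e => e
  | vert e => e + 1

/-- Number of columns. -/
def cols : Block → ℕ
  | jordan _ n => n
  | jordanInfty n => n
  | hor e => e + 1
  | vert e => e

/-- The entry of the `A`-part of a block in row `i` and column `j` (counted from `0`). -/
def entryA : Block → ℕ → ℕ → ℂ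
  | jordan c _, i, j => if i = j then c else if i + 1 = j then 1 else 0
  | jordanInfty _, i, j => if i = j then 1 else 0
  | hor _, i, j => if i = j then 1 else 0
  | vert _, i, j => if i = j then 1 else 0

/-- The entry of the `B`-part of a block in row `i` and column `j` (counted from `0`). -/
def entryB : Block → ℕ → ℕ → ℂ
  | jordan _ _, i, j => if i = j then 1 else 0
  | jordanInfty _, i, j => if i + 1 = j then 1 else 0
  | hor _, i, j => if i + 1 = j then 1 else 0
  | vert _, i, j => if i = j + 1 then 1 else 0

/-- The matrix `A_i` of a block. -/
def matA (b : Block) : Matrix (Fin b.rows) (Fin b.cols) ℂ :=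
  Matrix.of fun i j => b.entryA i j

/-- The matrix `B_i` of a block. -/
def matB (b : Block) : Matrix (Fin b.rows) (Fin b.cols) ℂ :=
  Matrix.of fun i j => b.entryB i j

/-- The eigenvalue of a Jordan block, a point of `ℂ ∪ {∞}`; none for Kronecker blocks. -/
def eigenvalue? : Block → Option (OnePoint ℂ)
  | jordan c _ => some (c : OnePoint ℂ)
  | jordanInfty _ => some OnePoint.infty
  | hor _ => none
  | vert _ => none

/-- The size of a Jordan block; `0` for Kronecker blocks. -/
def jordanSize : Block → ℕ
  | jordan _ n => n
  | jordanInfty n => n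
  | hor _ => 0
  | vert _ => 0

/-- The minimal column index contributed by a horizontal block. -/
def colIndex? : Block → Option ℕ
  | hor e => some e
  | _ => none

/-- The minimal row index contributed by a vertical block. -/
def rowIndex? : Block → Option ℕ
  | vert e => some e
  | _ => none

end Block

section Pencil

variable {U W : Type*} [AddCommGroup U] [Module ℂ U] [AddCommGroup W] [Module ℂ W]

/-- `L` is the list of blocks of a canonical form of the pencil `A + lambda B`: in suitable bases
of `U` and `W` the matrices of `A` and `B` are block-diagonal with blocks `A_i` and `B_i`. -/
def IsCanonicalForm (A B : U →ₗ[ℂ] W) (L : List Block) : Prop :=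
  ∃ (bU : Module.Basis (Σ i : Fin L.length, Fin (L.get i).cols) ℂ U)
    (bW : Module.Basis (Σ i : Fin L.length, Fin (L.get i).rows) ℂ W),
    LinearMap.toMatrix bU bW A = Matrix.blockDiagonal' (fun i => (L.get i).matA) ∧
    LinearMap.toMatrix bU bW B = Matrix.blockDiagonal' (fun i => (L.get i).matB)

/-- The eigenvalues (in `ℂ ∪ {∞}`) of the Jordan blocks in a list of blocks. -/
def jordanEigenvalues (L : List Block) : Set (OnePoint ℂ) :=
  {z | ∃ b ∈ L, b.eigenvalue? = some z}

/-- The sum of the sizes of all Jordan blocks (of finite and infinite eigenvalue). -/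
def totalJordanSize (L : List Block) : ℕ := (L.map Block.jordanSize).sum

/-- The algebraic type of a pencil. -/
@[ext] structure AlgebraicType where
  /-- for each distinct eigenvalue, the multiset of the sizes of its Jordan blocks -/
  jordanSizes : Multiset (Multiset ℕ)
  /-- the minimal column indices -/
  colIndices : Multiset ℕ
  /-- the minimal row indices -/
  rowIndices : Multiset ℕ

open Classical in
/-- The algebraic type read off from the blocks of a canonical form; the values of the
eigenvalues are forgotten, only how the Jordan blocks are grouped by eigenvalue is kept. -/
def algebraicType (L : List Block) : AlgebraicType where
  jordanSizes := (L.filterMap Block.eigenvalue?).toFinset.val.map fun z =>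
    (((L.filter fun b => b.eigenvalue? = some z).map Block.jordanSize : List ℕ) : Multiset ℕ)
  colIndices := (L.filterMap Block.colIndex? : List ℕ)
  rowIndices := (L.filterMap Block.rowIndex? : List ℕ)

/-- The pencil `A + lambda B` has algebraic type `T`. -/
def HasAlgebraicType (A B : U →ₗ[ℂ] W) (T : AlgebraicType) : Prop :=
  ∃ L : List Block, IsCanonicalForm A B L ∧ algebraicType L = T

/-- The polynomial functions on a vector space: the algebra of functions generated by the
linear functionals. -/
def polynomialFunctions (W : Type*) [AddCommGroup W] [Module ℂ W] : Subalgebra ℂ (W → ℂ) :=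
  Algebra.adjoin ℂ (Set.range fun φ : Module.Dual ℂ W => (φ : W → ℂ))

/-- Zariski open subsets of a vector space: complements of common zero sets of polynomial
functions. -/
def IsZariskiOpen (S : Set W) : Prop :=
  ∃ F : Set (W → ℂ), F ⊆ polynomialFunctions W ∧ S = {w | ∃ f ∈ F, f w ≠ 0}

end Pencil

/-! ### The operators `R_x` of a representation -/

section Representation

variable (𝔤 : Type*) {V : Type*} [LieRing 𝔤] [LieAlgebra ℂ 𝔤] [AddCommGroup V] [Module ℂ V]
  [LieRingModule 𝔤 V] [LieModule ℂ 𝔤 V]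

/-- The operator `R_x : 𝔤 → V`, `R_x ξ = ρ(ξ) x`; the representation `ρ` is the action
`ρ(ξ) x = ⁅ξ, x⁆` of the Lie algebra `𝔤` on its module `V`. -/
def R (x : V) : 𝔤 →ₗ[ℂ] V where
  toFun ξ := ⁅ξ, x⁆
  map_add' ξ η := add_lie ξ η x
  map_smul' c ξ := smul_lie c ξ x

/-- A point is regular if its stabiliser has minimal dimension. -/
def IsRegularPoint (a : V) : Prop :=
  ∀ x : V, Module.finrank ℂ (LinearMap.ker (R 𝔤 a)) ≤ Module.finrank ℂ (LinearMap.ker (R 𝔤 x))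

variable (V) in
/-- The set `Sing` of singular points. -/
def Sing : Set V := {x | ¬ IsRegularPoint 𝔤 x}

variable (V) in
/-- The dimension of a regular orbit, `r = max_x rk R_x`. -/
def regularOrbitDim : ℕ :=
  ⨆ x : V, Module.finrank ℂ (LinearMap.range (R 𝔤 x))

variable {𝔤} in
/-- The matrix of `R_x` with respect to bases of `𝔤` and `V`, with entries that are polynomials
in the coordinates `X_0, …, X_{n-1}` of `x = ∑ X_k v_k`. -/
def genericMatrix {m n : ℕ} (bg : Module.Basis (Fin m) ℂ 𝔤)
    (bV : Module.Basis (Fin n) ℂ V) : Matrix (Fin n) (Fin m) (MvPolynomial (Fin n) ℂ) :=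
  Matrix.of fun i j =>
    ∑ k : Fin n, MvPolynomial.C (LinearMap.toMatrix bg bV (R 𝔤 (bV k)) i j) * MvPolynomial.X k

variable {𝔤} in
/-- `p` is the fundamental semi-invariant (which is unique up to a nonzero constant): a greatest
common divisor of the `r × r` minors of the matrix of `R_x`, `r = max_x rk R_x`. -/
def IsFundamentalSemiInvariant {m n : ℕ}
    (bg : Module.Basis (Fin m) ℂ 𝔤) (bV : Module.Basis (Fin n) ℂ V)
    (p : MvPolynomial (Fin n) ℂ) : Prop :=
  ∀ q : MvPolynomial (Fin n) ℂ, q ∣ p ↔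
    ∀ (I : Fin (regularOrbitDim 𝔤 V) ↪o Fin n) (J : Fin (regularOrbitDim 𝔤 V) ↪o Fin m),
      q ∣ ((genericMatrix bg bV).submatrix I J).det

/-- A pair `(x, a)` is generic if the pencil `R_x + lambda R_a` has the algebraic type shared by
all pencils from a nonempty Zariski open subset of `V × V`. -/
def IsGenericPair (x a : V) : Prop :=
  ∃ T : AlgebraicType, HasAlgebraicType (R 𝔤 x) (R 𝔤 a) T ∧
    ∃ S : Set (V × V), IsZariskiOpen S ∧ S.Nonempty ∧
      ∀ q ∈ S, HasAlgebraicType (R 𝔤 q.1) (R 𝔤 q.2) T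

end Representation

end JordanKronecker

end

/-! Every block of `α A + β B`, with `α` or `β` a unit, is `P * D * Q` with `P` left invertible, `Q`
right invertible and `D` square. The determinant of `D` is `(α c + β) ^ n` or `α ^ n` for Jordan
blocks and `1` for Kronecker blocks. Hence the whole pencil has a square core whose size is the
generic rank and whose determinant is the product `pencilDet α β L`. Over a field the rank is
generic exactly where this determinant does not vanish; over any commutative `ℂ`-algebra the
determinant is a greatest common divisor of the minors of that size (`FactorsThrough.dvd_minor`,
`FactorsThrough.dvd_of_forall_dvd_minor`).

Eigenvalues: if `a` is regular, the generic rank is `r` and `pencilDet 0 1 L ≠ 0`, which excludes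
`∞`; and `x - c • a` is singular exactly when `pencilDet 1 (-c) L = 0`, that is, when `c` is an
eigenvalue.

Degree: write the `r × r` minors as `p * q i` with the `q i` coprime. On a generic line `x + t a`
the restrictions of the `q i` generate the unit ideal of `ℂ[t]` (`span_restrictLine_eq_top`), so the
restriction of `p` is associated to `pencilDet 1 t L`. Its degree is that of `p` on one side and the
total Jordan size on the other. An arbitrary generic pair is reached because two nonempty Zariski
open sets meet and the total Jordan size depends only on the algebraic type, and not on the chosen
canonical form. -/

namespace JordanKronecker

/-! ### Matrices that factor through an invertible-up-to-determinant core -/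

section FactorsThrough

set_option linter.unusedSectionVars false

variable {m n κ S : Type*} [Fintype m] [DecidableEq m] [Fintype n] [DecidableEq n]
  [Fintype κ] [DecidableEq κ] [CommRing S]

/-- `M = P * D * Q` where `P` has a left inverse, `Q` has a right inverse and the square matrix `D`
has rows indexed by `κ` and determinant `d`. -/
def FactorsThrough (κ : Type*) [Fintype κ] [DecidableEq κ] (M : Matrix m n S) (d : S) : Prop :=
  ∃ (P : Matrix m κ S) (P' : Matrix κ m S) (D : Matrix κ κ S) (Q : Matrix κ n S)
    (Q' : Matrix n κ S), M = P * D * Q ∧ P' * P = 1 ∧ Q * Q' = 1 ∧ D.det = d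

theorem factorsThrough_det (M : Matrix κ κ S) : FactorsThrough κ M M.det :=
  ⟨1, 1, M, 1, 1, by simp, by simp, by simp, rfl⟩

theorem FactorsThrough.transpose {M : Matrix m n S} {d : S} (h : FactorsThrough κ M d) :
    FactorsThrough κ M.transpose d := by
  obtain ⟨P, P', D, Q, Q', rfl, hP, hQ, rfl⟩ := h
  refine ⟨Q.transpose, Q'.transpose, D.transpose, P.transpose, P'.transpose, ?_, ?_, ?_, ?_⟩
  · simp [Matrix.transpose_mul, Matrix.mul_assoc]
  · rw [← Matrix.transpose_mul, hQ, Matrix.transpose_one]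
  · rw [← Matrix.transpose_mul, hP, Matrix.transpose_one]
  · exact Matrix.det_transpose D

/-- The inverse of the square submatrix, padded by zero rows, is a right inverse of `M`, so the core
can be taken to be `1`. -/
theorem factorsThrough_of_isUnit_det_submatrix (M : Matrix κ n S) (g : κ → n)
    (h : IsUnit (M.submatrix id g).det) : FactorsThrough κ M 1 := by
  refine ⟨1, 1, 1, M, (1 : Matrix n n S).submatrix id g * (M.submatrix id g)⁻¹, by simp, by simp,
    ?_, by simp⟩
  have : M * (1 : Matrix n n S).submatrix id g = M.submatrix id g := by
    ext i j
    simp [Matrix.mul_apply, Matrix.one_apply]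
  rw [← Matrix.mul_assoc, this, Matrix.mul_nonsing_inv _ h]

theorem FactorsThrough.mul_mul {m' n' : Type*} [Fintype m'] [DecidableEq m'] [Fintype n']
    [DecidableEq n'] {M : Matrix m n S} {d : S} (h : FactorsThrough κ M d)
    {E : Matrix m' m S} {E' : Matrix m m' S} (hE : E' * E = 1)
    {F : Matrix n n' S} {F' : Matrix n' n S} (hF : F * F' = 1) :
    FactorsThrough κ (E * M * F) d := by
  obtain ⟨P, P', D, Q, Q', rfl, hP, hQ, rfl⟩ := h
  refine ⟨E * P, P' * E', D, Q * F, F' * Q', by simp only [Matrix.mul_assoc], ?_, ?_, rfl⟩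
  · rw [Matrix.mul_assoc, ← Matrix.mul_assoc E', hE, Matrix.one_mul, hP]
  · rw [Matrix.mul_assoc, ← Matrix.mul_assoc F, hF, Matrix.one_mul, hQ]

theorem det_blockDiagonal'_eq_prod {o : ℕ} {k : Fin o → Type*} [∀ i, Fintype (k i)]
    [∀ i, DecidableEq (k i)] (D : ∀ i, Matrix (k i) (k i) S) :
    (Matrix.blockDiagonal' D).det = ∏ i, (D i).det := by
  rw [(Matrix.blockTriangular_blockDiagonal' D).det_fintype]
  refine Finset.prod_congr rfl fun i _ => ?_
  let e : k i ≃ {a : Σ i, k i // a.1 = i} :=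
    { toFun := fun x => ⟨⟨i, x⟩, rfl⟩
      invFun := fun a => a.2 ▸ a.1.2
      left_inv := fun x => rfl
      right_inv := by rintro ⟨⟨j, x⟩, rfl⟩; rfl }
  rw [← Matrix.det_submatrix_equiv_self e]
  congr 1
  ext x y
  exact Matrix.blockDiagonal'_apply_eq D i x y

theorem factorsThrough_blockDiagonal' {o : ℕ} {r c k : Fin o → Type*}
    [∀ i, Fintype (r i)] [∀ i, DecidableEq (r i)] [∀ i, Fintype (c i)] [∀ i, DecidableEq (c i)]
    [∀ i, Fintype (k i)] [∀ i, DecidableEq (k i)]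
    (M : ∀ i, Matrix (r i) (c i) S) (d : Fin o → S) (h : ∀ i, FactorsThrough (k i) (M i) (d i)) :
    FactorsThrough (Σ i, k i) (Matrix.blockDiagonal' M) (∏ i, d i) := by
  choose P P' D Q Q' hM hP hQ hD using h
  refine ⟨Matrix.blockDiagonal' P, Matrix.blockDiagonal' P', Matrix.blockDiagonal' D,
    Matrix.blockDiagonal' Q, Matrix.blockDiagonal' Q', ?_, ?_, ?_, ?_⟩
  · rw [funext hM, Matrix.blockDiagonal'_mul, Matrix.blockDiagonal'_mul]
  · rw [← Matrix.blockDiagonal'_mul, funext hP]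
    exact Matrix.blockDiagonal'_one
  · rw [← Matrix.blockDiagonal'_mul, funext hQ]
    exact Matrix.blockDiagonal'_one
  · simp_rw [det_blockDiagonal'_eq_prod, hD]

/-! ### Rank and minors -/

theorem FactorsThrough.rank_le {K : Type*} [Field K] {M : Matrix m n K} {d : K}
    (h : FactorsThrough κ M d) : M.rank ≤ Fintype.card κ := by
  obtain ⟨P, P', D, Q, Q', rfl, hP, hQ, rfl⟩ := h
  exact (Matrix.rank_mul_le_right _ _).trans (Matrix.rank_le_card_height _)

/-- Since `M = P * D * Q` and `D = P' * M * Q'`, the ranks of `M` and `D` agree. -/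
theorem FactorsThrough.rank_eq_card_iff {K : Type*} [Field K] {M : Matrix m n K} {d : K}
    (h : FactorsThrough κ M d) : M.rank = Fintype.card κ ↔ d ≠ 0 := by
  obtain ⟨P, P', D, Q, Q', rfl, hP, hQ, rfl⟩ := h
  have hD : D = P' * (P * D * Q) * Q' := by
    rw [Matrix.mul_assoc P, ← Matrix.mul_assoc P', hP, Matrix.one_mul, Matrix.mul_assoc, hQ,
      Matrix.mul_one]
  have h1 : D.rank ≤ (P * D * Q).rank := by
    conv_lhs => rw [hD]
    exact (Matrix.rank_mul_le_left _ _).trans (Matrix.rank_mul_le_right _ _)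
  have h2 : (P * D * Q).rank ≤ D.rank :=
    (Matrix.rank_mul_le_left _ _).trans (Matrix.rank_mul_le_right _ _)
  rw [le_antisymm h2 h1]
  constructor
  · intro h0
    have hspan : Submodule.span K (Set.range D.col) = ⊤ := by
      apply Submodule.eq_top_of_finrank_eq
      rw [← Matrix.rank_eq_finrank_span_cols, h0, Module.finrank_fintype_fun_eq_card]
    have hli : LinearIndependent K D.col :=
      linearIndependent_of_top_le_span_of_card_eq_finrank hspan.ge
        (Module.finrank_fintype_fun_eq_card K).symm
    rw [Matrix.linearIndependent_cols_iff_isUnit, Matrix.isUnit_iff_isUnit_det] at hli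
    exact hli.ne_zero
  · intro h0
    exact Matrix.rank_of_det_ne_zero h0

/-- A weak Cauchy–Binet formula: the rows of `P * N` are combinations of rows of `N`, and
multilinearity expands the determinant over all choices `f`, injective or not. -/
theorem dvd_det_mul_of_forall_dvd {g : S} (P : Matrix κ m S) (N : Matrix m κ S)
    (h : ∀ f : κ → m, g ∣ (N.submatrix f id).det) : g ∣ (P * N).det := by
  have : (P * N).det = Matrix.detRowAlternating fun i => ∑ k, P i k • N k := by
    change Matrix.detRowAlternating (P * N) = _
    congr 1
    ext i j
    simp [Matrix.mul_apply]
  rw [this, ← AlternatingMap.coe_multilinearMap, MultilinearMap.map_sum]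
  refine Finset.dvd_sum fun f _ => ?_
  rw [MultilinearMap.map_smul_univ]
  exact Dvd.dvd.mul_left (h f) _

theorem FactorsThrough.dvd_of_forall_dvd_minor {M : Matrix m n S} {d g : S}
    (h : FactorsThrough κ M d) (hg : ∀ (I : κ → m) (J : κ → n), g ∣ (M.submatrix I J).det) :
    g ∣ d := by
  obtain ⟨P, P', D, Q, Q', rfl, hP, hQ, rfl⟩ := h
  have hD : D = P' * (P * D * Q * Q') := by
    rw [Matrix.mul_assoc _ Q, hQ, Matrix.mul_one, ← Matrix.mul_assoc, hP, Matrix.one_mul]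
  rw [hD]
  refine dvd_det_mul_of_forall_dvd _ _ fun I => ?_
  rw [← Matrix.det_transpose]
  have : ((P * D * Q * Q').submatrix I id).transpose =
      Q'.transpose * ((P * D * Q).submatrix I id).transpose := by
    rw [← Matrix.transpose_mul]
    congr 1
  rw [this]
  refine dvd_det_mul_of_forall_dvd _ _ fun J => ?_
  rw [← Matrix.det_transpose]
  exact hg I J

theorem FactorsThrough.dvd_minor {M : Matrix m n S} {d : S} (h : FactorsThrough κ M d)
    (I : κ → m) (J : κ → n) : d ∣ (M.submatrix I J).det := by
  obtain ⟨P, P', D, Q, Q', rfl, hP, hQ, rfl⟩ := h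
  have : (P * D * Q).submatrix I J = P.submatrix I id * D * Q.submatrix id J := by
    ext i j
    simp [Matrix.mul_apply]
  rw [this, Matrix.det_mul, Matrix.det_mul]
  exact (dvd_mul_left _ _).mul_right _

/-- Divisibility of the minors with increasing rows and columns implies that of all minors. -/
theorem dvd_minor_of_forall_orderEmbedding {a b r : ℕ} {M : Matrix (Fin a) (Fin b) S} {g : S}
    (h : ∀ (I : Fin r ↪o Fin a) (J : Fin r ↪o Fin b), g ∣ (M.submatrix I J).det)
    (I : Fin r → Fin a) (J : Fin r → Fin b) : g ∣ (M.submatrix I J).det := by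
  have key : ∀ {c : ℕ} (f : Fin r → Fin c), Function.Injective f →
      ∃ (f' : Fin r ↪o Fin c) (s : Equiv.Perm (Fin r)), f = f' ∘ s := by
    intro c f hf
    have hs : StrictMono (f ∘ Tuple.sort f) :=
      (Tuple.monotone_sort f).strictMono_of_injective (hf.comp (Tuple.sort f).injective)
    exact ⟨OrderEmbedding.ofStrictMono _ hs, (Tuple.sort f)⁻¹, by ext i; simp⟩
  by_cases hI : Function.Injective I
  · by_cases hJ : Function.Injective J
    · obtain ⟨I', s, rfl⟩ := key I hI
      obtain ⟨J', t, rfl⟩ := key J hJ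
      have : M.submatrix (I' ∘ s) (J' ∘ t) = ((M.submatrix I' J').submatrix s id).submatrix id t :=
        rfl
      rw [this, Matrix.det_permute', Matrix.det_permute]
      exact Dvd.dvd.mul_left (Dvd.dvd.mul_left (h I' J') _) _
    · obtain ⟨i, j, hij, hne⟩ := Function.not_injective_iff.mp hJ
      rw [Matrix.det_zero_of_column_eq hne (by simp [hij])]
      exact dvd_zero g
  · obtain ⟨i, j, hij, hne⟩ := Function.not_injective_iff.mp hI
    rw [Matrix.det_zero_of_row_eq hne (by ext; simp [hij])]
    exact dvd_zero g

end FactorsThrough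

/-! ### The canonical form of a pencil factors through its core -/

namespace Block

variable {S : Type*} [CommRing S] [Algebra ℂ S]

/-- The generic rank of a block. -/
def coreSize : Block → ℕ
  | jordan _ n => n
  | jordanInfty n => n
  | hor e => e
  | vert e => e

/-- The determinant of the core of the block `α A + β B`. -/
def coreDet (α β : S) : Block → S
  | jordan c n => (α * algebraMap ℂ S c + β) ^ (n : ℕ)
  | jordanInfty n => α ^ (n : ℕ)
  | hor _ => 1
  | vert _ => 1

/-- The entry in row `i` and column `j` of the block `α A + β B`. -/
def pencilEntry (α β : S) (b : Block) (i j : ℕ) : S :=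
  α * algebraMap ℂ S (b.entryA i j) + β * algebraMap ℂ S (b.entryB i j)

/-- The block `α A + β B` with coefficients in a `ℂ`-algebra. -/
def pencil (α β : S) (b : Block) : Matrix (Fin b.rows) (Fin b.cols) S :=
  Matrix.of fun i j => b.pencilEntry α β i j

/-- Dropping the last column leaves an upper triangular square with diagonal `α`; dropping the first
leaves a lower triangular one with diagonal `β`. -/
theorem factorsThrough_pencil_hor {α β : S} (h : IsUnit α ∨ IsUnit β) (e : ℕ) :
    FactorsThrough (Fin e)
      (Matrix.of fun (i : Fin e) (j : Fin (e + 1)) => (hor e).pencilEntry α β i j) 1 := by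
  rcases h with h | h
  · refine factorsThrough_of_isUnit_det_submatrix _ Fin.castSucc ?_
    rw [Matrix.det_of_isUpperTriangular]
    · simpa [pencilEntry, entryA, entryB] using h.pow e
    · intro i j hij
      have h1 : (j : ℕ) < i := hij
      have h2 : (i : ℕ) ≠ j := by omega
      have h3 : (i : ℕ) + 1 ≠ j := by omega
      simp [pencilEntry, entryA, entryB, h2, h3]
  · refine factorsThrough_of_isUnit_det_submatrix _ Fin.succ ?_
    rw [← Matrix.det_transpose, Matrix.det_of_isUpperTriangular]
    · simpa [pencilEntry, entryA, entryB] using h.pow e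
    · intro i j hij
      have h1 : (j : ℕ) < i := hij
      have h2 : (j : ℕ) ≠ i + 1 := by omega
      have h3 : (j : ℕ) ≠ i := by omega
      simp [pencilEntry, entryA, entryB, h2, h3]

omit [Algebra ℂ S] in
theorem factorsThrough_of_isUpperTriangular {n : ℕ} (f : ℕ → ℕ → S) (a : S)
    (h0 : ∀ i j, j < i → f i j = 0) (ha : ∀ i, f i i = a) :
    FactorsThrough (Fin n) (Matrix.of fun i j : Fin n => f i j) (a ^ n) := by
  have hd : (Matrix.of fun i j : Fin n => f i j).det = a ^ n := by
    rw [Matrix.det_of_isUpperTriangular]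
    · simp [ha]
    · intro i j hij
      exact h0 i j hij
  rw [← hd]
  exact factorsThrough_det _

theorem factorsThrough_pencil {α β : S} (h : IsUnit α ∨ IsUnit β) (b : Block) :
    FactorsThrough (Fin b.coreSize) (b.pencil α β) (b.coreDet α β) := by
  cases b with
  | jordan c n =>
    refine factorsThrough_of_isUpperTriangular _ _ (fun i j hij => ?_) fun i => ?_
    · simp [pencilEntry, entryA, entryB, hij.ne', show i + 1 ≠ j by omega]
    · simp [pencilEntry, entryA, entryB]
  | jordanInfty n =>
    refine factorsThrough_of_isUpperTriangular _ _ (fun i j hij => ?_) fun i => ?_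
    · simp [pencilEntry, entryA, entryB, hij.ne', show i + 1 ≠ j by omega]
    · simp [pencilEntry, entryA, entryB]
  | hor e => exact factorsThrough_pencil_hor h e
  | vert e =>
    have : pencil α β (vert e) = (Matrix.of fun (i : Fin e) (j : Fin (e + 1)) =>
        (hor e).pencilEntry α β i j).transpose := by
      ext i j
      change pencilEntry α β (vert e) i j = pencilEntry α β (hor e) j i
      simp [pencilEntry, entryA, entryB, eq_comm]
    rw [this]
    exact (factorsThrough_pencil_hor h e).transpose

end Block

/-- The generic rank of a pencil with the given blocks. -/
def genericRank (L : List Block) : ℕ := (L.map Block.coreSize).sum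

/-- The determinant of the core of the pencil `α A + β B` with the given blocks. -/
def pencilDet {S : Type*} [CommRing S] [Algebra ℂ S] (α β : S) (L : List Block) : S :=
  (L.map (Block.coreDet α β)).prod

theorem FactorsThrough.congr_equiv {m n κ κ' S : Type*} [Fintype m] [DecidableEq m] [Fintype n]
    [DecidableEq n] [Fintype κ] [DecidableEq κ] [Fintype κ'] [DecidableEq κ'] [CommRing S]
    {M : Matrix m n S} {d : S} (h : FactorsThrough κ M d) (e : κ' ≃ κ) :
    FactorsThrough κ' M d := by
  obtain ⟨P, P', D, Q, Q', rfl, hP, hQ, rfl⟩ := h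
  refine ⟨P.submatrix id e, P'.submatrix e id, D.submatrix e e, Q.submatrix e id,
    Q'.submatrix id e, ?_, ?_, ?_, Matrix.det_submatrix_equiv_self e D⟩
  · simp [Matrix.submatrix_mul_equiv]
  · rw [← Matrix.submatrix_mul _ _ _ _ _ Function.bijective_id, hP, Matrix.submatrix_one_equiv]
  · rw [← Matrix.submatrix_mul _ _ _ _ _ Function.bijective_id, hQ, Matrix.submatrix_one_equiv]

theorem card_sigma_coreSize (L : List Block) :
    Fintype.card (Σ i : Fin L.length, Fin (L.get i).coreSize) = genericRank L := by
  simp [genericRank, Fin.sum_univ_fun_getElem L Block.coreSize]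

section Pencil

variable {U W : Type*} [AddCommGroup U] [Module ℂ U] [AddCommGroup W] [Module ℂ W]

theorem IsCanonicalForm.factorsThrough {A B : U →ₗ[ℂ] W} {L : List Block}
    (h : IsCanonicalForm A B L) {S : Type*} [CommRing S] [Algebra ℂ S] {α β : S}
    (hαβ : IsUnit α ∨ IsUnit β) {m n : Type*} [Fintype m] [DecidableEq m] [Fintype n]
    [DecidableEq n] (bU : Module.Basis n ℂ U) (bW : Module.Basis m ℂ W) :
    FactorsThrough (Fin (genericRank L))
      (α • (LinearMap.toMatrix bU bW A).map (algebraMap ℂ S) +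
        β • (LinearMap.toMatrix bU bW B).map (algebraMap ℂ S)) (pencilDet α β L) := by
  obtain ⟨cU, cW, hA, hB⟩ := h
  have h1 := factorsThrough_blockDiagonal' (fun i => (L.get i).pencil α β)
    (fun i => (L.get i).coreDet α β) fun i => (L.get i).factorsThrough_pencil hαβ
  have h2 : Matrix.blockDiagonal' (fun i => (L.get i).pencil α β) =
      α • (LinearMap.toMatrix cU cW A).map (algebraMap ℂ S) +
        β • (LinearMap.toMatrix cU cW B).map (algebraMap ℂ S) := by
    rw [hA, hB, Matrix.blockDiagonal'_map _ _ (map_zero _),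
      Matrix.blockDiagonal'_map _ _ (map_zero _), ← Matrix.blockDiagonal'_smul,
      ← Matrix.blockDiagonal'_smul, ← Matrix.blockDiagonal'_add]
    rfl
  have h3 : (∏ i, (L.get i).coreDet α β) = pencilDet α β L := by
    simp [pencilDet, Fin.prod_univ_fun_getElem L (Block.coreDet α β)]
  rw [h2, h3] at h1
  have h4 := h1.congr_equiv (Fintype.equivFinOfCardEq (card_sigma_coreSize L)).symm
  let f : ℂ →+* S := algebraMap ℂ S
  have hE : (cW.toMatrix bW).map f * (bW.toMatrix cW).map f = 1 := by
    rw [← Matrix.map_mul, Module.Basis.toMatrix_mul_toMatrix_flip]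
    simp
  have hF : (cU.toMatrix bU).map f * (bU.toMatrix cU).map f = 1 := by
    rw [← Matrix.map_mul, Module.Basis.toMatrix_mul_toMatrix_flip]
    simp
  have h5 := h4.mul_mul hE hF
  convert h5 using 1
  rw [← basis_toMatrix_mul_linearMap_toMatrix_mul_basis_toMatrix bU cU bW cW A,
    ← basis_toMatrix_mul_linearMap_toMatrix_mul_basis_toMatrix bU cU bW cW B]
  simp only [Matrix.map_mul, Matrix.mul_add, Matrix.add_mul, Matrix.mul_smul, Matrix.smul_mul, f]

end Pencil

/-! ### Degrees of the core determinant in the two affine charts -/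

open Polynomial in
theorem Block.coreDet_one_X_ne_zero (b : Block) : b.coreDet (1 : ℂ[X]) X ≠ 0 := by
  cases b with
  | jordan c n =>
    simp only [Block.coreDet, one_mul, Polynomial.algebraMap_eq, add_comm (C c)]
    exact pow_ne_zero _ (X_add_C_ne_zero c)
  | _ => simp [Block.coreDet]

open Polynomial in
theorem Block.C_mul_X_add_one_ne_zero (c : ℂ) : (X * C c + 1 : ℂ[X]) ≠ 0 := fun h => by
  simpa using congrArg (eval 0) h

open Polynomial in
theorem Block.coreDet_X_one_ne_zero (b : Block) : b.coreDet (X : ℂ[X]) 1 ≠ 0 := by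
  cases b with
  | jordan c n =>
    simp only [Block.coreDet, Polynomial.algebraMap_eq]
    exact pow_ne_zero _ (Block.C_mul_X_add_one_ne_zero c)
  | _ => simp [Block.coreDet]

open Polynomial in
-- Finite eigenvalues are counted by the degree in the chart `(1, X)`; the eigenvalue `∞` is the
-- point `X = 0` of the chart `(X, 1)` and is counted by the order of vanishing there.
theorem Block.jordanSize_eq (b : Block) : b.jordanSize =
    (b.coreDet (1 : ℂ[X]) X).natDegree + (b.coreDet (X : ℂ[X]) 1).natTrailingDegree := by
  cases b with
  | jordan c n =>
    have h : (((X : ℂ[X]) * C c + 1) ^ (n : ℕ)).natTrailingDegree = 0 := by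
      rw [natTrailingDegree_eq_zero, coeff_zero_eq_eval_zero]
      simp
    simp only [Block.coreDet, one_mul, Polynomial.algebraMap_eq, add_comm (C c), h]
    simp [Block.jordanSize]
  | jordanInfty n => simp [Block.jordanSize, Block.coreDet]
  | hor e => simp [Block.jordanSize, Block.coreDet]
  | vert e => simp [Block.jordanSize, Block.coreDet]

section PencilDet

variable {S : Type*} [CommRing S] [Algebra ℂ S]

theorem pencilDet_cons (α β : S) (b : Block) (L : List Block) :
    pencilDet α β (b :: L) = b.coreDet α β * pencilDet α β L := by
  simp [pencilDet]

theorem pencilDet_eq_zero_iff [IsDomain S] (α β : S) (L : List Block) :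
    pencilDet α β L = 0 ↔ ∃ b ∈ L, b.coreDet α β = 0 := by
  simp [pencilDet, List.prod_eq_zero_iff]

theorem map_pencilDet {T : Type*} [CommRing T] [Algebra ℂ T] (f : S →ₐ[ℂ] T) (α β : S)
    (L : List Block) : f (pencilDet α β L) = pencilDet (f α) (f β) L := by
  rw [pencilDet, pencilDet, map_list_prod, List.map_map]
  congr 2
  ext b
  cases b <;> simp [Block.coreDet]

open Polynomial in
theorem pencilDet_one_X_ne_zero (L : List Block) : pencilDet (1 : ℂ[X]) X L ≠ 0 := by
  rw [Ne, pencilDet_eq_zero_iff]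
  rintro ⟨b, -, hb⟩
  exact b.coreDet_one_X_ne_zero hb

open Polynomial in
theorem pencilDet_X_one_ne_zero (L : List Block) : pencilDet (X : ℂ[X]) 1 L ≠ 0 := by
  rw [Ne, pencilDet_eq_zero_iff]
  rintro ⟨b, -, hb⟩
  exact b.coreDet_X_one_ne_zero hb

open Polynomial in
theorem totalJordanSize_eq (L : List Block) : totalJordanSize L =
    (pencilDet (1 : ℂ[X]) X L).natDegree + (pencilDet (X : ℂ[X]) 1 L).natTrailingDegree := by
  induction L with
  | nil => simp [totalJordanSize, pencilDet]
  | cons b L ih =>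
    have h : totalJordanSize (b :: L) = b.jordanSize + totalJordanSize L := by
      simp [totalJordanSize]
    rw [h, pencilDet_cons, pencilDet_cons,
      natDegree_mul b.coreDet_one_X_ne_zero (pencilDet_one_X_ne_zero L),
      natTrailingDegree_mul b.coreDet_X_one_ne_zero (pencilDet_X_one_ne_zero L), ih,
      b.jordanSize_eq]
    ring

open Polynomial in
/-- If `∞` is not an eigenvalue, only the finite eigenvalues contribute. -/
theorem totalJordanSize_eq_natDegree {L : List Block} (h : pencilDet (0 : ℂ) 1 L ≠ 0) :
    totalJordanSize L = (pencilDet (1 : ℂ[X]) X L).natDegree := by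
  rw [totalJordanSize_eq, Nat.add_eq_left, natTrailingDegree_eq_zero]
  right
  have h1 : aeval (0 : ℂ) (pencilDet (X : ℂ[X]) 1 L) = pencilDet (0 : ℂ) 1 L := by
    rw [map_pencilDet, aeval_X, map_one]
  rw [coeff_zero_eq_eval_zero, ← coe_aeval_eq_eval, h1]
  exact h

open Polynomial in
theorem exists_pencilDet_ne_zero (L L' : List Block) :
    ∃ c : ℂ, pencilDet 1 c L ≠ 0 ∧ pencilDet 1 c L' ≠ 0 := by
  obtain ⟨c, hc⟩ := exists_eval_ne_zero_of_natDegree_lt_card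
    (pencilDet (1 : ℂ[X]) X L * pencilDet (1 : ℂ[X]) X L')
    (mul_ne_zero (pencilDet_one_X_ne_zero L) (pencilDet_one_X_ne_zero L'))
    ((Cardinal.natCast_lt_aleph0).trans_le (Cardinal.aleph0_le_mk ℂ))
  refine ⟨c, ?_⟩
  rw [← coe_aeval_eq_eval, map_mul, map_pencilDet, map_pencilDet, aeval_X, map_one] at hc
  exact mul_ne_zero_iff.mp hc

end PencilDet

/-! ### Rank criterion and invariance of the total Jordan size -/

section Pencil

variable {U W : Type*} [AddCommGroup U] [Module ℂ U] [AddCommGroup W] [Module ℂ W]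

theorem rank_toMatrix_eq_finrank_range {m n : Type*} [Fintype m] [DecidableEq m] [Fintype n]
    [DecidableEq n] (bU : Module.Basis n ℂ U) (bW : Module.Basis m ℂ W) (f : U →ₗ[ℂ] W) :
    (LinearMap.toMatrix bU bW f).rank = Module.finrank ℂ (LinearMap.range f) := by
  rw [Matrix.rank_eq_finrank_range_toLin _ bW bU, Matrix.toLin_toMatrix]

variable [FiniteDimensional ℂ U] [FiniteDimensional ℂ W] {A B : U →ₗ[ℂ] W} {L L' : List Block}

theorem IsCanonicalForm.factorsThrough_toMatrix (h : IsCanonicalForm A B L) {α β : ℂ}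
    (hαβ : IsUnit α ∨ IsUnit β) :
    FactorsThrough (Fin (genericRank L))
      (LinearMap.toMatrix (Module.finBasis ℂ U) (Module.finBasis ℂ W) (α • A + β • B))
      (pencilDet α β L) := by
  convert h.factorsThrough hαβ (Module.finBasis ℂ U) (Module.finBasis ℂ W) using 1
  ext i j
  simp

theorem IsCanonicalForm.finrank_range_le (h : IsCanonicalForm A B L) {α β : ℂ}
    (hαβ : IsUnit α ∨ IsUnit β) :
    Module.finrank ℂ (LinearMap.range (α • A + β • B)) ≤ genericRank L := by
  rw [← rank_toMatrix_eq_finrank_range (Module.finBasis ℂ U) (Module.finBasis ℂ W)]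
  simpa using (h.factorsThrough_toMatrix hαβ).rank_le

theorem IsCanonicalForm.finrank_range_eq_iff (h : IsCanonicalForm A B L) {α β : ℂ}
    (hαβ : IsUnit α ∨ IsUnit β) :
    Module.finrank ℂ (LinearMap.range (α • A + β • B)) = genericRank L ↔ pencilDet α β L ≠ 0 := by
  rw [← rank_toMatrix_eq_finrank_range (Module.finBasis ℂ U) (Module.finBasis ℂ W)]
  simpa using (h.factorsThrough_toMatrix hαβ).rank_eq_card_iff

/-- Both numbers are the rank of `A + c B` at a point `c` where neither core determinant vanishes.
-/
theorem IsCanonicalForm.genericRank_eq (h : IsCanonicalForm A B L)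
    (h' : IsCanonicalForm A B L') : genericRank L = genericRank L' := by
  obtain ⟨c, hc, hc'⟩ := exists_pencilDet_ne_zero L L'
  rw [← (h.finrank_range_eq_iff (Or.inl isUnit_one)).mpr hc,
    ← (h'.finrank_range_eq_iff (Or.inl isUnit_one)).mpr hc']

/-- Both determinants are greatest common divisors of the same minors, as the core sizes agree. -/
theorem IsCanonicalForm.pencilDet_dvd (h : IsCanonicalForm A B L) (h' : IsCanonicalForm A B L')
    {S : Type*} [CommRing S] [Algebra ℂ S] {α β : S} (hαβ : IsUnit α ∨ IsUnit β) :
    pencilDet α β L ∣ pencilDet α β L' := by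
  have h1 := h.factorsThrough hαβ (Module.finBasis ℂ U) (Module.finBasis ℂ W)
  have h2 := h'.factorsThrough hαβ (Module.finBasis ℂ U) (Module.finBasis ℂ W)
  rw [h.genericRank_eq h'] at h1
  exact h2.dvd_of_forall_dvd_minor h1.dvd_minor

open Polynomial in
/-- The sum of the sizes of the Jordan blocks does not depend on the canonical form. -/
theorem IsCanonicalForm.totalJordanSize_eq (h : IsCanonicalForm A B L)
    (h' : IsCanonicalForm A B L') : totalJordanSize L = totalJordanSize L' := by
  rw [JordanKronecker.totalJordanSize_eq, JordanKronecker.totalJordanSize_eq]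
  have h1 : Associated (pencilDet (1 : ℂ[X]) X L) (pencilDet (1 : ℂ[X]) X L') :=
    associated_of_dvd_dvd (h.pencilDet_dvd h' (Or.inl isUnit_one))
      (h'.pencilDet_dvd h (Or.inl isUnit_one))
  have h2 : Associated (pencilDet (X : ℂ[X]) 1 L) (pencilDet (X : ℂ[X]) 1 L') :=
    associated_of_dvd_dvd (h.pencilDet_dvd h' (Or.inr isUnit_one))
      (h'.pencilDet_dvd h (Or.inr isUnit_one))
  congr 1
  · exact natDegree_eq_of_degree_eq (degree_eq_degree_of_associated h1)
  · obtain ⟨u, hu⟩ := h2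
    obtain ⟨c, hc, hcu⟩ := Polynomial.isUnit_iff.mp u.isUnit
    rw [← hu, natTrailingDegree_mul (pencilDet_X_one_ne_zero L) u.ne_zero, ← hcu,
      natTrailingDegree_C, add_zero]

open Classical in
-- The set `s` may be larger than the set of eigenvalues, which lets it stay fixed in the induction.
theorem sum_jordanSize_filter_eq (L : List Block) (s : Finset (OnePoint ℂ))
    (hs : ∀ b ∈ L, ∀ z, b.eigenvalue? = some z → z ∈ s) :
    ∑ z ∈ s, ((L.filter fun b => b.eigenvalue? = some z).map Block.jordanSize).sum =
      totalJordanSize L := by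
  induction L with
  | nil => simp [totalJordanSize]
  | cons b L ih =>
    have h : totalJordanSize (b :: L) = b.jordanSize + totalJordanSize L := by
      simp [totalJordanSize]
    rw [h, ← ih fun b' hb' => hs b' (List.mem_cons_of_mem _ hb')]
    have h1 : ∀ z, (((b :: L).filter fun b => b.eigenvalue? = some z).map Block.jordanSize).sum =
        (if b.eigenvalue? = some z then b.jordanSize else 0) +
          ((L.filter fun b => b.eigenvalue? = some z).map Block.jordanSize).sum := by
      intro z
      by_cases hz : b.eigenvalue? = some z <;> simp [hz]
    simp_rw [h1, Finset.sum_add_distrib]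
    congr 1
    rcases hb : b.eigenvalue? with _ | z
    · cases b <;> simp_all [Block.eigenvalue?, Block.jordanSize]
    · simp [hs b List.mem_cons_self z hb]

theorem sum_jordanSizes_algebraicType (L : List Block) :
    ((algebraicType L).jordanSizes.map Multiset.sum).sum = totalJordanSize L := by
  classical
  rw [← sum_jordanSize_filter_eq L (L.filterMap Block.eigenvalue?).toFinset]
  · simp only [algebraicType, Multiset.map_map, Finset.sum]
    congr 1
  · intro b hb z hz
    simp only [List.mem_toFinset, List.mem_filterMap]
    exact ⟨b, hb, hz⟩

end Pencil

/-! ### Regular points -/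

section Representation

variable {𝔤 V : Type*} [LieRing 𝔤] [LieAlgebra ℂ 𝔤] [AddCommGroup V] [Module ℂ V]
  [LieRingModule 𝔤 V] [LieModule ℂ 𝔤 V]

theorem R_smul_add_smul (α β : ℂ) (x a : V) :
    R 𝔤 (α • x + β • a) = α • R 𝔤 x + β • R 𝔤 a := by
  ext ξ
  simp [R]

variable [FiniteDimensional ℂ V]

theorem bddAbove_finrank_range : BddAbove (Set.range fun x : V =>
    Module.finrank ℂ (LinearMap.range (R 𝔤 x))) :=
  ⟨Module.finrank ℂ V, by rintro _ ⟨x, rfl⟩; exact Submodule.finrank_le _⟩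

theorem finrank_range_le_regularOrbitDim (x : V) :
    Module.finrank ℂ (LinearMap.range (R 𝔤 x)) ≤ regularOrbitDim 𝔤 V :=
  le_ciSup (bddAbove_finrank_range (𝔤 := 𝔤)) x

variable (𝔤 V) in
theorem exists_finrank_range_eq : ∃ x : V,
    Module.finrank ℂ (LinearMap.range (R 𝔤 x)) = regularOrbitDim 𝔤 V :=
  Nat.sSup_mem (Set.range_nonempty _) (bddAbove_finrank_range (𝔤 := 𝔤) (V := V))

variable [FiniteDimensional ℂ 𝔤]

theorem isRegularPoint_iff (a : V) : IsRegularPoint 𝔤 a ↔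
    Module.finrank ℂ (LinearMap.range (R 𝔤 a)) = regularOrbitDim 𝔤 V := by
  have h := fun x : V => LinearMap.finrank_range_add_finrank_ker (R 𝔤 x)
  constructor
  · intro ha
    obtain ⟨x, hx⟩ := exists_finrank_range_eq 𝔤 V
    refine le_antisymm (finrank_range_le_regularOrbitDim a) ?_
    have := ha x
    have := h x
    have := h a
    omega
  · intro ha x
    have := finrank_range_le_regularOrbitDim (𝔤 := 𝔤) x
    have := h x
    have := h a
    omega

/-- The generic rank is attained by some `R_{x + c a}`, hence is at most `r`; it bounds the rank of
the member `R_a` of the pencil, which is `r`. -/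
theorem IsRegularPoint.genericRank_eq {x a : V} (ha : IsRegularPoint 𝔤 a) {L : List Block}
    (hL : IsCanonicalForm (R 𝔤 x) (R 𝔤 a) L) : genericRank L = regularOrbitDim 𝔤 V := by
  apply le_antisymm
  · obtain ⟨c, hc, -⟩ := exists_pencilDet_ne_zero L L
    rw [← (hL.finrank_range_eq_iff (Or.inl isUnit_one)).mpr hc, ← R_smul_add_smul]
    exact finrank_range_le_regularOrbitDim _
  · rw [← (isRegularPoint_iff a).mp ha]
    have h := hL.finrank_range_le (α := 0) (β := 1) (Or.inr isUnit_one)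
    rwa [zero_smul, zero_add, one_smul] at h

theorem IsRegularPoint.pencilDet_ne_zero {x a : V} (ha : IsRegularPoint 𝔤 a) {L : List Block}
    (hL : IsCanonicalForm (R 𝔤 x) (R 𝔤 a) L) : pencilDet (0 : ℂ) 1 L ≠ 0 := by
  rw [← hL.finrank_range_eq_iff (Or.inr isUnit_one), ha.genericRank_eq hL,
    ← (isRegularPoint_iff a).mp ha, zero_smul, zero_add, one_smul]

theorem IsRegularPoint.sub_smul_mem_Sing_iff {x a : V} (ha : IsRegularPoint 𝔤 a) {L : List Block}
    (hL : IsCanonicalForm (R 𝔤 x) (R 𝔤 a) L) (c : ℂ) :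
    x - c • a ∈ Sing 𝔤 V ↔ pencilDet 1 (-c) L = 0 := by
  have h1 : x - c • a = (1 : ℂ) • x + (-c) • a := by simp [sub_eq_add_neg]
  rw [← not_iff_not, ← Ne, ← hL.finrank_range_eq_iff (Or.inl isUnit_one), ha.genericRank_eq hL,
    ← R_smul_add_smul, ← h1, ← isRegularPoint_iff]
  exact not_not

theorem IsRegularPoint.jordanEigenvalues_eq {x a : V} (ha : IsRegularPoint 𝔤 a) {L : List Block}
    (hL : IsCanonicalForm (R 𝔤 x) (R 𝔤 a) L) :
    jordanEigenvalues L =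
      (fun c : ℂ => (c : OnePoint ℂ)) '' {c : ℂ | x - c • a ∈ Sing 𝔤 V} := by
  ext z
  simp only [jordanEigenvalues, Set.mem_ofPred_eq, Set.mem_image, ha.sub_smul_mem_Sing_iff hL,
    pencilDet_eq_zero_iff]
  constructor
  · rintro ⟨b, hb, hz⟩
    cases b with
    | jordan c n => exact ⟨c, ⟨_, hb, by simp [Block.coreDet]⟩, by simpa [Block.eigenvalue?] using hz⟩
    | jordanInfty n =>
      refine absurd ?_ (ha.pencilDet_ne_zero hL)
      exact (pencilDet_eq_zero_iff _ _ _).mpr ⟨_, hb, by simp [Block.coreDet]⟩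
    | hor e => simp [Block.eigenvalue?] at hz
    | vert e => simp [Block.eigenvalue?] at hz
  · rintro ⟨c, ⟨b, hb, h0⟩, rfl⟩
    refine ⟨b, hb, ?_⟩
    cases b with
    | jordan c' n =>
      have : c' = c := by simpa [Block.coreDet, add_neg_eq_zero] using h0
      simp [Block.eigenvalue?, this]
    | jordanInfty n => simp [Block.coreDet] at h0
    | hor e => simp [Block.coreDet] at h0
    | vert e => simp [Block.coreDet] at h0

end Representation

/-! ### Zariski open sets -/

section Zariski

open Polynomial

variable {W : Type*} [AddCommGroup W] [Module ℂ W]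

theorem exists_polynomial_eval_eq {f : W → ℂ} (hf : f ∈ polynomialFunctions W) (w v : W) :
    ∃ P : ℂ[X], ∀ t : ℂ, P.eval t = f (w + t • v) := by
  induction hf using Algebra.adjoin_induction with
  | mem f hf =>
    obtain ⟨φ, rfl⟩ := hf
    exact ⟨C (φ w) + C (φ v) * X, fun t => by
      simp only [eval_add, eval_mul, eval_C, eval_X, map_add, map_smul, smul_eq_mul, mul_comm]⟩
  | algebraMap c => exact ⟨C c, fun t => by simp⟩
  | add f g _ _ hf hg =>
    obtain ⟨P, hP⟩ := hf
    obtain ⟨Q, hQ⟩ := hg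
    exact ⟨P + Q, fun t => by simp [hP, hQ]⟩
  | mul f g _ _ hf hg =>
    obtain ⟨P, hP⟩ := hf
    obtain ⟨Q, hQ⟩ := hg
    exact ⟨P * Q, fun t => by simp [hP, hQ]⟩

/-- Two nonempty Zariski open sets meet. -/
theorem IsZariskiOpen.inter_nonempty {S T : Set W} (hS : IsZariskiOpen S) (hT : IsZariskiOpen T)
    (hS' : S.Nonempty) (hT' : T.Nonempty) : (S ∩ T).Nonempty := by
  obtain ⟨F, hF, rfl⟩ := hS
  obtain ⟨G, hG, rfl⟩ := hT
  obtain ⟨w, f, hf, hfw⟩ := hS'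
  obtain ⟨v, g, hg, hgv⟩ := hT'
  -- Restrict to the line through `w` (at `t = 0`) and `v` (at `t = 1`).
  obtain ⟨P, hP⟩ := exists_polynomial_eval_eq (hF hf) w (v - w)
  obtain ⟨Q, hQ⟩ := exists_polynomial_eval_eq (hG hg) w (v - w)
  have hP0 : P ≠ 0 := by
    rintro rfl
    exact hfw (by simpa using (hP 0).symm)
  have hQ0 : Q ≠ 0 := by
    rintro rfl
    exact hgv (by simpa using (hQ 1).symm)
  obtain ⟨t, ht⟩ := exists_eval_ne_zero_of_natDegree_lt_card (P * Q) (mul_ne_zero hP0 hQ0)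
    (Cardinal.natCast_lt_aleph0.trans_le (Cardinal.aleph0_le_mk ℂ))
  rw [eval_mul, hP, hQ] at ht
  exact ⟨_, ⟨f, hf, left_ne_zero_of_mul ht⟩, ⟨g, hg, right_ne_zero_of_mul ht⟩⟩

end Zariski

/-! ### Restriction of polynomials to lines -/

section Lines

open Polynomial

variable {n : ℕ}

/-- Evaluation of a polynomial in the coordinates of a pair of points. -/
noncomputable def pairEval (x a : Fin n → ℂ) : MvPolynomial (Fin n) (MvPolynomial (Fin n) ℂ) →+* ℂ :=
  MvPolynomial.eval₂Hom (MvPolynomial.eval x) a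

/-- The inner variables are the coordinates of `x`, the outer ones those of `a`: choose `x` to keep
one coefficient nonzero, then `a`. -/
theorem exists_pairEval_ne_zero {P : MvPolynomial (Fin n) (MvPolynomial (Fin n) ℂ)} (hP : P ≠ 0) :
    ∃ x a, pairEval x a P ≠ 0 := by
  obtain ⟨s, hs⟩ := MvPolynomial.ne_zero_iff.mp hP
  obtain ⟨x, hx⟩ : ∃ x, MvPolynomial.eval x (P.coeff s) ≠ 0 := by
    by_contra! h
    exact hs (MvPolynomial.funext fun x => by simpa using h x)
  have h0 : MvPolynomial.map (MvPolynomial.eval x) P ≠ 0 :=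
    MvPolynomial.ne_zero_iff.mpr ⟨s, by rwa [MvPolynomial.coeff_map]⟩
  obtain ⟨a, ha⟩ : ∃ a, MvPolynomial.eval a (MvPolynomial.map (MvPolynomial.eval x) P) ≠ 0 := by
    by_contra! h
    exact h0 (MvPolynomial.funext fun a => by simpa using h a)
  exact ⟨x, a, by rwa [MvPolynomial.eval_map] at ha⟩

theorem pairEval_mem_polynomialFunctions {V : Type*} [AddCommGroup V] [Module ℂ V]
    (bV : Module.Basis (Fin n) ℂ V) (P : MvPolynomial (Fin n) (MvPolynomial (Fin n) ℂ)) :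
    (fun q : V × V => pairEval (bV.repr q.1) (bV.repr q.2) P) ∈ polynomialFunctions (V × V) := by
  have hlin : ∀ φ : Module.Dual ℂ (V × V), (φ : V × V → ℂ) ∈ polynomialFunctions (V × V) :=
    fun φ => Algebra.subset_adjoin ⟨φ, rfl⟩
  have hadd : ∀ {P Q : MvPolynomial (Fin n) (MvPolynomial (Fin n) ℂ)},
      (fun q : V × V => pairEval (bV.repr q.1) (bV.repr q.2) P) ∈ polynomialFunctions (V × V) →
      (fun q : V × V => pairEval (bV.repr q.1) (bV.repr q.2) Q) ∈ polynomialFunctions (V × V) →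
      (fun q : V × V => pairEval (bV.repr q.1) (bV.repr q.2) (P + Q)) ∈
        polynomialFunctions (V × V) := fun hP hQ => by
    simp_rw [map_add]
    exact add_mem hP hQ
  have hmul : ∀ {P Q : MvPolynomial (Fin n) (MvPolynomial (Fin n) ℂ)},
      (fun q : V × V => pairEval (bV.repr q.1) (bV.repr q.2) P) ∈ polynomialFunctions (V × V) →
      (fun q : V × V => pairEval (bV.repr q.1) (bV.repr q.2) Q) ∈ polynomialFunctions (V × V) →
      (fun q : V × V => pairEval (bV.repr q.1) (bV.repr q.2) (P * Q)) ∈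
        polynomialFunctions (V × V) := fun hP hQ => by
    simp_rw [map_mul]
    exact mul_mem hP hQ
  induction P using MvPolynomial.induction_on with
  | C p =>
    induction p using MvPolynomial.induction_on with
    | C c =>
      convert (polynomialFunctions (V × V)).algebraMap_mem c using 1
      ext q
      simp [pairEval]
    | add p q hp hq => rw [map_add]; exact hadd hp hq
    | mul_X p k hp =>
      rw [map_mul]
      refine hmul hp ?_
      convert hlin (bV.coord k ∘ₗ LinearMap.fst ℂ V V) using 1
      ext q
      simp [pairEval]
  | add p q hp hq => exact hadd hp hq
  | mul_X p k hp =>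
    refine hmul hp ?_
    convert hlin (bV.coord k ∘ₗ LinearMap.snd ℂ V V) using 1
    ext q
    simp [pairEval]

/-- The substitution `x ↦ x + t a` for generic `x` and `a`. -/
noncomputable def toLine : MvPolynomial (Fin n) ℂ →ₐ[ℂ] (MvPolynomial (Fin n) (MvPolynomial (Fin n) ℂ))[X] :=
  MvPolynomial.aeval fun k => C (MvPolynomial.C (MvPolynomial.X k)) + X * C (MvPolynomial.X k)

/-- The restriction of a polynomial to the line `x + t a`. -/
noncomputable def restrictLine (x a : Fin n → ℂ) : MvPolynomial (Fin n) ℂ →ₐ[ℂ] ℂ[X] :=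
  MvPolynomial.aeval fun k => C (x k) + X * C (a k)

theorem map_pairEval_toLine (x a : Fin n → ℂ) (p : MvPolynomial (Fin n) ℂ) :
    (toLine p).map (pairEval x a) = restrictLine x a p := by
  have h : (mapRingHom (pairEval x a)).comp (toLine (n := n)).toRingHom =
      (restrictLine x a : MvPolynomial (Fin n) ℂ →+* ℂ[X]) := by
    apply MvPolynomial.ringHom_ext
    · intro c
      simp [toLine, restrictLine, pairEval, MvPolynomial.algebraMap_eq]
    · intro k
      simp [toLine, restrictLine, pairEval]
  exact congrArg (fun f : _ →+* _ => f p) h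

/-- The substitution `x ↦ x + z t a`. -/
noncomputable def shear (n : ℕ) (z : ℂ) : (MvPolynomial (Fin n) (MvPolynomial (Fin n) ℂ))[X] →+*
    (MvPolynomial (Fin n) (MvPolynomial (Fin n) ℂ))[X] :=
  eval₂RingHom (MvPolynomial.eval₂Hom
    (MvPolynomial.aeval fun k => C (MvPolynomial.C (MvPolynomial.X k)) +
      C (MvPolynomial.C (MvPolynomial.C z)) * X * C (MvPolynomial.X k) :
      MvPolynomial (Fin n) ℂ →ₐ[ℂ] (MvPolynomial (Fin n) (MvPolynomial (Fin n) ℂ))[X]).toRingHom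
    fun k => C (MvPolynomial.X k)) X

theorem shear_comp_shear {z z' : ℂ} (h : z + z' = 0) :
    (shear n z).comp (shear n z') = RingHom.id _ := by
  have hz : C (MvPolynomial.C (MvPolynomial.C z)) + C (MvPolynomial.C (MvPolynomial.C z')) =
      (0 : (MvPolynomial (Fin n) (MvPolynomial (Fin n) ℂ))[X]) := by
    simp only [← map_add, h, map_zero]
  apply Polynomial.ringHom_ext'
  · apply MvPolynomial.ringHom_ext'
    · apply MvPolynomial.ringHom_ext
      · intro c
        simp [shear, MvPolynomial.algebraMap_eq]
      · intro k
        simp [shear, MvPolynomial.algebraMap_eq]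
        rw [add_assoc, ← add_mul, ← add_mul, hz, zero_mul, zero_mul, add_zero]
    · intro k
      simp [shear]
  · simp [shear]

/-- Replacing `x` by `x - t a` straightens the line: `p (x + t a)` becomes `p x`, free of `t` and
`a`. -/
theorem shear_neg_one_toLine (p : MvPolynomial (Fin n) ℂ) :
    shear n (-1) (toLine p) = C (MvPolynomial.C p) := by
  have h : (shear n (-1)).comp (toLine (n := n)).toRingHom = C.comp MvPolynomial.C := by
    apply MvPolynomial.ringHom_ext
    · intro c
      simp [toLine, shear, MvPolynomial.algebraMap_eq]
    · intro k
      simp [toLine, shear]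
      ring
  exact congrArg (fun f : _ →+* _ => f p) h

/-- Over a domain a divisor of a nonzero constant is constant; applied first to `X` and then to the
variables `σ`, this puts the common divisor in `B`. -/
theorem isUnit_of_forall_dvd_C_C {B σ ι : Type*} [CommRing B] [IsDomain B] {q : ι → B}
    (hq : ∀ e, (∀ i, e ∣ q i) → IsUnit e) {d : (MvPolynomial σ B)[X]}
    (hd : ∀ i, d ∣ C (MvPolynomial.C (q i))) : IsUnit d := by
  obtain ⟨i, hi⟩ : ∃ i, q i ≠ 0 := by
    by_contra! h
    exact not_isUnit_zero (hq 0 fun i => by rw [h i])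
  obtain ⟨r, rfl⟩ : ∃ r, d = C r := by
    have : d.natDegree = 0 := by
      have := natDegree_le_of_dvd (hd i) (by simpa using hi)
      simpa using this
    exact ⟨_, eq_C_of_natDegree_eq_zero this⟩
  have h3 : ∀ i, r ∣ MvPolynomial.C (q i) := fun i => by
    simpa using (C_dvd_iff_dvd_coeff _ _).mp (hd i) 0
  obtain ⟨e, -, rfl⟩ := (MvPolynomial.dvd_C_iff_exists hi).mp (h3 i)
  refine ((hq e fun i => ?_).map MvPolynomial.C).map C
  simpa using (MvPolynomial.C_dvd_iff_dvd_coeff _ _).mp (h3 i) 0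

/-- Coprime polynomials have coprime restrictions to the generic line. -/
theorem isUnit_of_forall_dvd_toLine {ι : Type*} {q : ι → MvPolynomial (Fin n) ℂ}
    (hq : ∀ e, (∀ i, e ∣ q i) → IsUnit e) (d) (hd : ∀ i, d ∣ toLine (q i)) : IsUnit d := by
  have h1 : IsUnit (shear n (-1) d) := isUnit_of_forall_dvd_C_C hq fun i => by
    have h := map_dvd (shear n (-1)) (hd i)
    rwa [shear_neg_one_toLine] at h
  have h2 := h1.map (shear n 1)
  rwa [← RingHom.comp_apply, shear_comp_shear (by norm_num)] at h2

/-- Coprime polynomials over a factorial domain generate an ideal that contains a nonzero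
constant. -/
theorem exists_C_mem_span_range {A : Type*} [CommRing A] [IsDomain A]
    [UniqueFactorizationMonoid A] {ι : Type*} {f : ι → A[X]}
    (hf : ∀ d, (∀ i, d ∣ f i) → IsUnit d) : ∃ D : A, D ≠ 0 ∧ C D ∈ Ideal.span (Set.range f) := by
  let : NormalizedGCDMonoid A := Nonempty.some inferInstance
  let K := FractionRing A
  let φ : A[X] →+* K[X] := mapRingHom (algebraMap A K)
  let I : Ideal K[X] := (Ideal.span (Set.range f)).map φ
  -- Over the fraction field the ideal has a generator `g`; `h` is `g` with denominators cleared.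
  obtain ⟨g, hg⟩ : ∃ g, I = Ideal.span {g} := (IsPrincipalIdealRing.principal I).principal
  obtain ⟨b, hbM, hb⟩ := IsLocalization.integerNormalization_spec (nonZeroDivisors A) g
  set h := IsLocalization.integerNormalization (nonZeroDivisors A) g
  have hb0 : algebraMap A K b ≠ 0 := by
    simpa using nonZeroDivisors.ne_zero hbM
  have hgh : C (algebraMap A K b) * g = φ h := by
    rw [coe_mapRingHom, hb, ← algebraMap_smul K, smul_eq_C_mul]
  have hbu : IsUnit (C (algebraMap A K b)) := isUnit_C.mpr (isUnit_iff_ne_zero.mpr hb0)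
  -- Gauss's lemma: a primitive polynomial that divides over `K` divides over `A`.
  have hdvd : ∀ i, h.primPart ∣ f i := fun i => by
    apply h.isPrimitive_primPart.dvd_of_fraction_map_dvd_fraction_map (K := K)
    have h1 : φ (f i) ∈ I := Ideal.mem_map_of_mem φ (Ideal.subset_span ⟨i, rfl⟩)
    rw [hg, Ideal.mem_span_singleton] at h1
    refine (map_dvd φ h.primPart_dvd).trans ?_
    rw [← hgh]
    exact (hbu.mul_left_dvd).mpr h1
  have hu : IsUnit h.primPart := hf _ hdvd
  have hh : h ≠ 0 := by
    intro h0
    rw [h0, map_zero, mul_eq_zero, or_iff_right hbu.ne_zero] at hgh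
    refine not_isUnit_zero (hf 0 fun i => ?_)
    have h1 : φ (f i) ∈ I := Ideal.mem_map_of_mem φ (Ideal.subset_span ⟨i, rfl⟩)
    rw [hg, hgh, Ideal.mem_span_singleton, zero_dvd_iff, coe_mapRingHom, Polynomial.map_eq_zero_iff
      (IsFractionRing.injective A K)] at h1
    rw [h1]
  have hgu : IsUnit g := by
    apply isUnit_of_mul_isUnit_right (x := C (algebraMap A K b))
    rw [hgh, h.eq_C_content_mul_primPart, map_mul]
    refine IsUnit.mul ?_ (hu.map φ)
    have hc : algebraMap A K h.content ≠ 0 := by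
      rwa [Ne, map_eq_zero_iff _ (IsFractionRing.injective A K), content_eq_zero_iff]
    rw [coe_mapRingHom, map_C]
    exact isUnit_C.mpr hc.isUnit
  have hI : (1 : K[X]) ∈ I := by
    rw [hg, Ideal.span_singleton_eq_top.mpr hgu]
    trivial
  let _ : Algebra A[X] K[X] := Polynomial.algebra A K
  have : IsLocalization ((nonZeroDivisors A).map C) K[X] :=
    Polynomial.isLocalization (nonZeroDivisors A) K
  -- Clearing denominators in `1 ∈ I` puts a nonzero constant in the original ideal.
  obtain ⟨⟨⟨u, hu⟩, ⟨v, hv⟩⟩, huv⟩ :=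
    (IsLocalization.mem_map_algebraMap_iff ((nonZeroDivisors A).map C) K[X]).mp hI
  obtain ⟨D, hD, rfl⟩ := hv
  refine ⟨D, nonZeroDivisors.ne_zero hD, ?_⟩
  have huv' : φ (C D) = φ u := by rwa [one_mul] at huv
  rwa [map_injective _ (IsFractionRing.injective A K) huv']

theorem span_restrictLine_eq_top {ι : Type*} {q : ι → MvPolynomial (Fin n) ℂ}
    (hq : ∀ e, (∀ i, e ∣ q i) → IsUnit e) :
    ∃ D : MvPolynomial (Fin n) (MvPolynomial (Fin n) ℂ), D ≠ 0 ∧ ∀ x a, pairEval x a D ≠ 0 →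
      Ideal.span (Set.range fun i => restrictLine x a (q i)) = ⊤ := by
  obtain ⟨D, hD, hmem⟩ := exists_C_mem_span_range (isUnit_of_forall_dvd_toLine hq)
  refine ⟨D, hD, fun x a hxa => ?_⟩
  have h := Ideal.mem_map_of_mem (mapRingHom (pairEval x a)) hmem
  rw [Ideal.map_span, ← Set.range_comp] at h
  have h1 : (mapRingHom (pairEval x a) ∘ fun i => toLine (q i)) =
      fun i => restrictLine x a (q i) := funext fun i => map_pairEval_toLine x a (q i)
  rw [h1] at h
  refine Ideal.eq_top_of_isUnit_mem _ h ?_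
  simpa using hxa

/-- The restriction of a polynomial to the generic line has the same degree. -/
theorem natDegree_toLine (p : MvPolynomial (Fin n) ℂ) :
    (toLine p).natDegree = p.totalDegree := by
  apply le_antisymm
  · rw [toLine, MvPolynomial.aeval_def, MvPolynomial.eval₂_eq]
    refine natDegree_sum_le_of_forall_le _ _ fun s hs => ?_
    refine (natDegree_C_mul_le _ _).trans ?_
    refine (natDegree_prod_le _ _).trans ?_
    refine (Finset.sum_le_sum fun k _ => ?_).trans (MvPolynomial.le_totalDegree hs)
    refine natDegree_pow_le.trans ?_
    refine (Nat.mul_le_mul_left _ (?_ : _ ≤ 1)).trans (mul_one _).le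
    compute_degree
  · by_cases hp : p = 0
    · simp [hp]
    -- Setting `x = 0` leaves `p (t a)`, whose coefficient of `t ^ d` is the homogeneous component
    -- of degree `d`.
    let ψ : (MvPolynomial (Fin n) (MvPolynomial (Fin n) ℂ))[X] →+* (MvPolynomial (Fin n) ℂ)[X] :=
      mapRingHom (MvPolynomial.map (MvPolynomial.eval 0))
    have hψ : ∀ p, ψ (toLine p) = MvPolynomial.aeval (fun k => X * C (MvPolynomial.X k)) p := by
      have h : ψ.comp (toLine (n := n)).toRingHom = (MvPolynomial.aeval (R := ℂ)
          fun k => (X * C (MvPolynomial.X k) : (MvPolynomial (Fin n) ℂ)[X])).toRingHom := by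
        apply MvPolynomial.ringHom_ext
        · intro c
          simp [ψ, toLine, MvPolynomial.algebraMap_eq]
        · intro k
          simp [ψ, toLine]
      exact fun p => congrArg (fun f : _ →+* _ => f p) h
    have key : ∀ (d : ℕ) (p : MvPolynomial (Fin n) ℂ),
        (ψ (toLine p)).coeff d = MvPolynomial.homogeneousComponent d p := by
      intro d p
      induction p using MvPolynomial.induction_on' with
      | add p q hp hq => simp only [map_add, coeff_add, hp, hq]
      | monomial s c =>
        have : ψ (toLine (MvPolynomial.monomial s c)) =
            C (MvPolynomial.monomial s c) * X ^ s.degree := by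
          rw [hψ, MvPolynomial.aeval_monomial, MvPolynomial.monomial_eq, Finsupp.prod, Finsupp.prod,
            map_mul, map_prod, Finsupp.degree_apply]
          simp_rw [mul_pow, map_pow]
          rw [Finset.prod_mul_distrib, Finset.prod_pow_eq_pow_sum, Polynomial.algebraMap_apply,
            MvPolynomial.algebraMap_eq]
          ring
        rw [this, coeff_C_mul_X_pow, MvPolynomial.homogeneousComponent_of_mem
          (MvPolynomial.isHomogeneous_monomial c rfl)]
    have hc : (ψ (toLine p)).coeff p.totalDegree ≠ 0 := by
      rw [key]
      obtain ⟨s, hs, hs'⟩ : ∃ s ∈ p.support, s.degree = p.totalDegree := by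
        obtain ⟨s, hs, h⟩ := Finset.exists_mem_eq_sup p.support
          (MvPolynomial.support_nonempty.mpr hp) fun s => s.sum fun _ e => e
        exact ⟨s, hs, h.symm⟩
      rw [MvPolynomial.ne_zero_iff]
      refine ⟨s, ?_⟩
      rw [MvPolynomial.coeff_homogeneousComponent, if_pos hs']
      exact MvPolynomial.mem_support_iff.mp hs
    exact (le_natDegree_of_ne_zero hc).trans natDegree_map_le

end Lines

/-! ### Minors of the generic matrix and the degree of the semi-invariant -/

section SemiInvariant

open Polynomial

variable {𝔤 V : Type*} [LieRing 𝔤] [LieAlgebra ℂ 𝔤] [AddCommGroup V] [Module ℂ V]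
  [LieRingModule 𝔤 V] [LieModule ℂ 𝔤 V] {m n : ℕ} (bg : Module.Basis (Fin m) ℂ 𝔤)
  (bV : Module.Basis (Fin n) ℂ V)

theorem toMatrix_R_eq_sum (x : V) (i : Fin n) (j : Fin m) :
    LinearMap.toMatrix bg bV (R 𝔤 x) i j =
      ∑ k, bV.repr x k * LinearMap.toMatrix bg bV (R 𝔤 (bV k)) i j := by
  conv_lhs => rw [← bV.sum_repr x]
  simp only [LinearMap.toMatrix_apply, R, LinearMap.coe_mk, AddHom.coe_mk, lie_sum, lie_smul,
    map_sum, map_smul, Finsupp.finsetSum_apply, Finsupp.smul_apply, smul_eq_mul]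

theorem restrictLine_genericMatrix (x a : V) :
    (genericMatrix bg bV).map (restrictLine (bV.repr x) (bV.repr a)) =
      (1 : ℂ[X]) • (LinearMap.toMatrix bg bV (R 𝔤 x)).map (algebraMap ℂ ℂ[X]) +
        (X : ℂ[X]) • (LinearMap.toMatrix bg bV (R 𝔤 a)).map (algebraMap ℂ ℂ[X]) := by
  ext1 i j
  simp only [genericMatrix, Matrix.map_apply, Matrix.of_apply, Matrix.add_apply, Matrix.smul_apply,
    toMatrix_R_eq_sum bg bV x, toMatrix_R_eq_sum bg bV a, map_sum, map_mul, restrictLine,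
    MvPolynomial.aeval_X, MvPolynomial.aeval_C, smul_eq_mul, one_mul, Finset.mul_sum,
    ← Finset.sum_add_distrib, Polynomial.algebraMap_eq]
  exact Finset.sum_congr rfl fun k _ => by ring

theorem eval_genericMatrix (x : V) :
    (genericMatrix bg bV).map (MvPolynomial.eval (bV.repr x)) =
      LinearMap.toMatrix bg bV (R 𝔤 x) := by
  ext1 i j
  simp only [genericMatrix, Matrix.map_apply, Matrix.of_apply, toMatrix_R_eq_sum bg bV x, map_sum,
    map_mul, MvPolynomial.eval_X, MvPolynomial.eval_C]
  exact Finset.sum_congr rfl fun k _ => by ring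

/-- A matrix of rank `r` has a nonzero minor of size `r` with increasing rows and columns. -/
theorem exists_minor_ne_zero {K : Type*} [Field K] {r : ℕ} (M : Matrix (Fin n) (Fin m) K)
    (hM : M.rank = r) : ∃ (I : Fin r ↪o Fin n) (J : Fin r ↪o Fin m), (M.submatrix I J).det ≠ 0 := by
  -- Choose rows forming a basis of the row space; the same selection on the transpose then chooses
  -- the columns.
  have hrow : ∀ {n m : ℕ} (N : Matrix (Fin n) (Fin m) K), N.rank = r →
      ∃ I : Fin r → Fin n, (N.submatrix I id).rank = r := by
    intro n m N hN
    rw [Matrix.rank_eq_finrank_span_row] at hN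
    obtain ⟨f, hf, -, hli⟩ := Submodule.exists_fun_fin_finrank_span_eq K (Set.range N.row)
    choose I hI using hf
    subst hN
    refine ⟨I, ?_⟩
    have h : (N.submatrix I id).row = f := funext hI
    rw [← h] at hli
    rw [hli.rank_matrix, Fintype.card_fin]
  obtain ⟨I, hI⟩ := hrow M hM
  rw [← Matrix.rank_transpose] at hI
  obtain ⟨J, hJ⟩ := hrow _ hI
  have hdet : (M.submatrix I J).det ≠ 0 := by
    rw [← Matrix.det_transpose]
    exact ((factorsThrough_det (κ := Fin r) _).rank_eq_card_iff).mp
      (hJ.trans (Fintype.card_fin r).symm)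
  by_contra! h
  exact hdet (zero_dvd_iff.mp (dvd_minor_of_forall_orderEmbedding
    (fun I J => zero_dvd_iff.mpr (h I J)) I J))

/-- A matrix with a nonzero minor of size `r` has rank at least `r`. -/
theorem le_rank_of_minor_ne_zero {K : Type*} [Field K] {r : ℕ} (M : Matrix (Fin n) (Fin m) K)
    (I : Fin r → Fin n) (J : Fin r → Fin m) (h : (M.submatrix I J).det ≠ 0) : r ≤ M.rank := by
  have h1 := Matrix.rank_of_det_ne_zero h
  rw [Fintype.card_fin] at h1
  rw [← h1]
  exact Matrix.rank_submatrix_le _ _ _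

variable [FiniteDimensional ℂ V]

theorem exists_generic_minor_ne_zero :
    ∃ (I : Fin (regularOrbitDim 𝔤 V) ↪o Fin n) (J : Fin (regularOrbitDim 𝔤 V) ↪o Fin m),
      ((genericMatrix bg bV).submatrix I J).det ≠ 0 := by
  obtain ⟨x, hx⟩ := exists_finrank_range_eq 𝔤 V
  rw [← rank_toMatrix_eq_finrank_range bg bV] at hx
  obtain ⟨I, J, h⟩ := exists_minor_ne_zero _ hx
  refine ⟨I, J, fun h0 => h ?_⟩
  have h1 := RingHom.map_det (MvPolynomial.eval (bV.repr x)) ((genericMatrix bg bV).submatrix I J)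
  rw [h0, map_zero] at h1
  rw [← eval_genericMatrix]
  exact h1.symm

variable [FiniteDimensional ℂ 𝔤]

theorem isRegularPoint_of_minor_ne_zero {a : V}
    (I : Fin (regularOrbitDim 𝔤 V) ↪o Fin n) (J : Fin (regularOrbitDim 𝔤 V) ↪o Fin m)
    (h : MvPolynomial.eval (bV.repr a) ((genericMatrix bg bV).submatrix I J).det ≠ 0) :
    IsRegularPoint 𝔤 a := by
  rw [isRegularPoint_iff]
  refine le_antisymm (finrank_range_le_regularOrbitDim a) ?_
  rw [← rank_toMatrix_eq_finrank_range bg bV]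
  refine le_rank_of_minor_ne_zero _ I J ?_
  rw [RingHom.map_det] at h
  rwa [← eval_genericMatrix]

/-- The degree of the fundamental semi-invariant is the sum of the sizes of the Jordan blocks for
all pairs in a nonempty Zariski open set. -/
theorem exists_isZariskiOpen_totalDegree_eq {p : MvPolynomial (Fin n) ℂ}
    (hp : IsFundamentalSemiInvariant bg bV p) :
    ∃ S : Set (V × V), IsZariskiOpen S ∧ S.Nonempty ∧ ∀ q ∈ S, ∀ L : List Block,
      IsCanonicalForm (R 𝔤 q.1) (R 𝔤 q.2) L → p.totalDegree = totalJordanSize L := by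
  let r := regularOrbitDim 𝔤 V
  let minor : (Fin r ↪o Fin n) × (Fin r ↪o Fin m) → MvPolynomial (Fin n) ℂ :=
    fun IJ => ((genericMatrix bg bV).submatrix IJ.1 IJ.2).det
  obtain ⟨I₀, J₀, h0⟩ := exists_generic_minor_ne_zero bg bV
  have hdvd : ∀ IJ, p ∣ minor IJ := fun IJ => (hp p).mp dvd_rfl IJ.1 IJ.2
  have hp0 : p ≠ 0 := fun h => h0 (zero_dvd_iff.mp (h ▸ hdvd (I₀, J₀)))
  choose q hq using hdvd
  have hcop : ∀ e, (∀ i, e ∣ q i) → IsUnit e := fun e he => by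
    have h1 : p * e ∣ p := (hp _).mpr fun I J => by
      change _ ∣ minor (I, J)
      rw [hq]
      exact mul_dvd_mul_left p (he _)
    have h2 : p * e ∣ p * 1 := by rwa [mul_one]
    exact isUnit_of_dvd_one ((mul_dvd_mul_iff_left hp0).mp h2)
  obtain ⟨D, hD, hspan⟩ := span_restrictLine_eq_top hcop
  -- The nonzero minor is written in the outer variables, so that it is evaluated at `a`.
  let M₀ : MvPolynomial (Fin n) (MvPolynomial (Fin n) ℂ) := MvPolynomial.map MvPolynomial.C
    (minor (I₀, J₀))
  have hM₀ : M₀ ≠ 0 := fun h => h0 (MvPolynomial.map_injective _ (MvPolynomial.C_injective _ _)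
    (h.trans (map_zero _).symm))
  have hlc : (toLine p).leadingCoeff ≠ 0 := by
    rw [Ne, leadingCoeff_eq_zero]
    intro h
    have h1 := shear_neg_one_toLine p
    rw [h, map_zero] at h1
    exact hp0 (MvPolynomial.C_eq_zero.mp (C_eq_zero.mp h1.symm))
  -- Where `E` does not vanish, the quotients `q` generate the unit ideal on the line, `a` is
  -- regular, and `p` keeps its degree on the line.
  let E := D * M₀ * (toLine p).leadingCoeff
  have hE : E ≠ 0 := mul_ne_zero (mul_ne_zero hD hM₀) hlc
  refine ⟨{w | ∃ f ∈ ({fun q : V × V => pairEval (bV.repr q.1) (bV.repr q.2) E} : Set _), f w ≠ 0},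
    ⟨_, ?_, rfl⟩, ?_, ?_⟩
  · rintro _ rfl
    exact pairEval_mem_polynomialFunctions bV E
  · obtain ⟨x, a, hxa⟩ := exists_pairEval_ne_zero hE
    refine ⟨(bV.equivFun.symm x, bV.equivFun.symm a), _, rfl, ?_⟩
    simp only [← Module.Basis.equivFun_apply, LinearEquiv.apply_symm_apply]
    exact hxa
  · rintro ⟨x, a⟩ ⟨_, rfl, hxa⟩ L hL
    simp only [E, map_mul, mul_ne_zero_iff] at hxa
    obtain ⟨⟨hxD, hxM⟩, hxl⟩ := hxa
    have ha : IsRegularPoint 𝔤 a := by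
      refine isRegularPoint_of_minor_ne_zero bg bV I₀ J₀ ?_
      have : pairEval (bV.repr x) (bV.repr a) M₀ =
          MvPolynomial.eval (bV.repr a) (minor (I₀, J₀)) := by
        simp only [pairEval, M₀, MvPolynomial.coe_eval₂Hom, MvPolynomial.eval₂_map]
        congr 1
        ext c
        simp
      rwa [this] at hxM
    let ψ := restrictLine (bV.repr x) (bV.repr a)
    have hdeg : (ψ p).natDegree = p.totalDegree := by
      rw [← natDegree_toLine, ← map_pairEval_toLine]
      exact natDegree_map_of_leadingCoeff_ne_zero _ hxl
    rw [totalJordanSize_eq_natDegree (ha.pencilDet_ne_zero hL), ← hdeg]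
    have hfac := hL.factorsThrough (S := ℂ[X]) (α := 1) (β := X) (Or.inl isUnit_one) bg bV
    rw [ha.genericRank_eq hL, ← restrictLine_genericMatrix] at hfac
    have hminor : ∀ IJ, (((genericMatrix bg bV).map ψ).submatrix IJ.1 IJ.2).det = ψ p * ψ (q IJ) :=
      fun IJ => by
        rw [← map_mul, ← hq]
        simp only [minor]
        rw [AlgHom.map_det]
        rfl
    have h1 : ψ p ∣ pencilDet 1 X L := by
      refine hfac.dvd_of_forall_dvd_minor (dvd_minor_of_forall_orderEmbedding fun I J => ?_)
      exact ⟨_, hminor (I, J)⟩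
    have h2 : pencilDet 1 X L ∣ ψ p := by
      -- The admissible `u` form an ideal containing every `ψ (q i)`, hence `1`.
      have hle : ∀ u ∈ Ideal.span (Set.range fun i => ψ (q i)), pencilDet 1 X L ∣ ψ p * u := by
        intro u hu
        induction hu using Submodule.span_induction with
        | mem u hu =>
          obtain ⟨IJ, rfl⟩ := hu
          rw [← hminor]
          exact hfac.dvd_minor _ _
        | zero => simp
        | add u v _ _ hu hv => rw [mul_add]; exact dvd_add hu hv
        | smul c u _ hu => rw [smul_eq_mul, mul_left_comm]; exact hu.mul_left c
      simpa using hle 1 (by rw [hspan _ _ hxD]; trivial)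
    exact (natDegree_eq_of_degree_eq (degree_eq_degree_of_associated (associated_of_dvd_dvd h1 h2)))

end SemiInvariant

end JordanKronecker

theorem mainTheorem9 {𝔤 V : Type*} [LieRing 𝔤] [LieAlgebra ℂ 𝔤] [FiniteDimensional ℂ 𝔤]
    [AddCommGroup V] [Module ℂ V] [FiniteDimensional ℂ V]
    [LieRingModule 𝔤 V] [LieModule ℂ 𝔤 V] :
    -- eigenvalues of the Jordan blocks for regular `a` (in particular `∞` is not one of them)
    (∀ x a : V, JordanKronecker.IsRegularPoint 𝔤 a →
      ∀ L : List JordanKronecker.Block,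
        JordanKronecker.IsCanonicalForm (JordanKronecker.R 𝔤 x) (JordanKronecker.R 𝔤 a) L →
        JordanKronecker.jordanEigenvalues L =
          (fun c : ℂ => (c : OnePoint ℂ)) '' {c : ℂ | x - c • a ∈ JordanKronecker.Sing 𝔤 V}) ∧
    -- degree of the fundamental semi-invariant, computed in any bases
    (∀ (m n : ℕ) (bg : Module.Basis (Fin m) ℂ 𝔤) (bV : Module.Basis (Fin n) ℂ V)
        (p : MvPolynomial (Fin n) ℂ),
      JordanKronecker.IsFundamentalSemiInvariant bg bV p →
      -- for every pair whose algebraic type is the generic one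
      (∀ x a : V, JordanKronecker.IsGenericPair 𝔤 x a →
        ∀ L : List JordanKronecker.Block,
          JordanKronecker.IsCanonicalForm (JordanKronecker.R 𝔤 x) (JordanKronecker.R 𝔤 a) L →
          p.totalDegree = JordanKronecker.totalJordanSize L) ∧
      -- and for all pairs of a nonempty Zariski open set
      (∃ S : Set (V × V), JordanKronecker.IsZariskiOpen S ∧ S.Nonempty ∧
        ∀ q ∈ S, ∀ L : List JordanKronecker.Block,
          JordanKronecker.IsCanonicalForm (JordanKronecker.R 𝔤 q.1) (JordanKronecker.R 𝔤 q.2) L →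
          p.totalDegree = JordanKronecker.totalJordanSize L)) := by
  refine ⟨fun x a ha L hL => ha.jordanEigenvalues_eq hL, fun m n bg bV p hp => ?_⟩
  have hS := JordanKronecker.exists_isZariskiOpen_totalDegree_eq bg bV hp
  refine ⟨?_, hS⟩
  rintro x a ⟨T, ⟨L₀, hL₀, hT⟩, S', hS', hne', hT'⟩ L hL
  obtain ⟨S, hS, hne, hdeg⟩ := hS
  -- At `w` the degree formula holds and the algebraic type is `T`, the type of the given pair.
  obtain ⟨w, hw, hw'⟩ := hS.inter_nonempty hS' hne hne'
  obtain ⟨L₁, hL₁, hT₁⟩ := hT' w hw'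
  rw [hdeg w hw L₁ hL₁, ← JordanKronecker.sum_jordanSizes_algebraicType, hT₁, ← hT,
    JordanKronecker.sum_jordanSizes_algebraicType, hL₀.totalJordanSize_eq hL]
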